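/- Let $R$ be a commutative Noetherian local ring of Krull dimension $d\geq 1$ with $\operatorname{Ass}_R R=\{\mathfrak p\}$, where $\mathfrak p$ is a nonzero principal ideal. Then $(0:_R\mathfrak p)\cong R/\mathfrak p$ as $R$-modules, where $(0:_R\mathfrak p)=\{r\in R : r\mathfrak p=0\}$. If moreover $R$ is Gorenstein (that is, $R$ has finite injective dimension as a module over itself), then $\mathfrak p$ is a Gorenstein ideal, where an ideal $I$ of a Gorenstein local ring $R$ is called a Gorenstein ideal if the local ring $R/I$ is also Gorenstein. -/

import Mathlib

open CategoryTheory

/-- A Gorenstein local ring: a Noetherian local ring that has finite injective dimension as a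
module over itself. -/
structure IsGorensteinLocalRing (R : Type*) [CommRing R] : Prop
    extends IsLocalRing R, IsNoetherianRing R where
  finite_injectiveDimension : ∃ n : ℕ, HasInjectiveDimensionLE (ModuleCat.of R R) n

/-- A Gorenstein ideal: an ideal `I` in a Gorenstein local ring `R` such that the factor ring
`R ⧸ I` is also a Gorenstein local ring. -/
structure IsGorensteinIdeal {R : Type*} [CommRing R] (I : Ideal R) : Prop where
  ring : IsGorensteinLocalRing R
  quotient : IsGorensteinLocalRing (R ⧸ I)

universe u v

/-! Write `p = (x)`. As `p` is the only associated prime, `x` is nilpotent and everything outside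
`p` is a nonzerodivisor. If `y` is the last nonzero power of `x`, then `x` and `y` have each other's
ideals as annihilators, so `(0 : x) = yR ≅ R/(x)`. The free resolution of `R/(x)` is therefore
2-periodic, alternating `x` and `y`, and `Ext^i(R/(x), R) = 0` for `i > 0`. Hence `Hom(R/(x), -)`,
realised as `x`-torsion, keeps an injective resolution of `R` exact, and bounds the injective
dimension of `(0 : x) ≅ R/(x)` over `R/(x)`. -/

/-- Multiplication by `a` and by `b` on `M` have the property that the kernel of each is contained
in the image of the other. -/
structure IsExactSMulPair {R : Type*} [CommRing R] (M : Type*) [AddCommGroup M] [Module R M]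
    (a b : R) : Prop where
  exists_of_smul_left : ∀ m : M, a • m = 0 → ∃ n : M, m = b • n
  exists_of_smul_right : ∀ m : M, b • m = 0 → ∃ n : M, m = a • n

section ExactPair

variable {R : Type u} [CommRing R] {a b : R}

theorem IsExactSMulPair.symm {M : Type v} [AddCommGroup M] [Module R M]
    (h : IsExactSMulPair M a b) : IsExactSMulPair M b a :=
  ⟨h.2, h.1⟩

/-- Multiplication by `b` embeds `R/(a)` in `R`; the map `1 ↦ m` on `R/(a)` extends along it, and
the image of `1` is the witness. -/
theorem IsExactSMulPair.exists_of_baer {M : Type v} [AddCommGroup M] [Module R M]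
    (h : IsExactSMulPair R a b) (hab : a * b = 0) (hM : Module.Baer R M) (m : M)
    (hm : a • m = 0) : ∃ n : M, m = b • n := by
  have hf : Ideal.span {a} ≤ LinearMap.ker (LinearMap.toSpanSingleton R R b) := by
    rw [Ideal.span_singleton_le_iff_mem]
    simpa using hab
  have hg : Ideal.span {a} ≤ LinearMap.ker (LinearMap.toSpanSingleton R M m) := by
    rw [Ideal.span_singleton_le_iff_mem]
    simpa using hm
  let f : (R ⧸ Ideal.span {a}) →ₗ[R] R := Submodule.liftQ _ _ hf
  let g : (R ⧸ Ideal.span {a}) →ₗ[R] M := Submodule.liftQ _ _ hg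
  have hinj : Function.Injective f := by
    refine (injective_iff_map_eq_zero f).mpr fun q hq => ?_
    obtain ⟨r, rfl⟩ := Submodule.Quotient.mk_surjective _ q
    have hr : b • r = 0 := by rw [smul_eq_mul, mul_comm]; exact hq
    obtain ⟨s, rfl⟩ := h.exists_of_smul_right r hr
    exact (Submodule.Quotient.mk_eq_zero _).mpr (Ideal.mul_mem_right _ _
      (Ideal.mem_span_singleton_self a))
  obtain ⟨e, he⟩ := hM.extension_property f hinj g
  refine ⟨e 1, ?_⟩
  have h1 := LinearMap.congr_fun he (Submodule.Quotient.mk 1)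
  have h2 : e b = m := by
    have h3 : e ((1 : R) • b) = (1 : R) • m := h1
    rwa [one_smul, one_smul] at h3
  rw [← map_smul, smul_eq_mul, mul_one, h2]

theorem IsExactSMulPair.of_baer {M : Type v} [AddCommGroup M] [Module R M]
    (h : IsExactSMulPair R a b) (hab : a * b = 0) (hM : Module.Baer R M) :
    IsExactSMulPair M a b :=
  ⟨h.exists_of_baer hab hM, h.symm.exists_of_baer (mul_comm a b ▸ hab) hM⟩

/-- The long exact homology sequence of the 2-periodic complexes, done as a diagram chase; it
carries exactness to cosyzygies. -/
theorem IsExactSMulPair.of_exact {M I C : Type*} [AddCommGroup M] [Module R M]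
    [AddCommGroup I] [Module R I] [AddCommGroup C] [Module R C] {f : M →ₗ[R] I} {g : I →ₗ[R] C}
    (hf : Function.Injective f) (hfg : Function.Exact f g) (hg : Function.Surjective g)
    (hab : a * b = 0) (hM : IsExactSMulPair M a b) (hI : IsExactSMulPair I a b) :
    IsExactSMulPair C a b := by
  have key : ∀ {a b : R}, a * b = 0 → IsExactSMulPair M a b → IsExactSMulPair I a b →
      ∀ c : C, a • c = 0 → ∃ n : C, c = b • n := by
    intro a b hab hM hI c hc
    obtain ⟨i, rfl⟩ := hg c
    obtain ⟨m, hm⟩ := (hfg (a • i)).mp (by rw [map_smul, hc])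
    have hbm : b • m = 0 := hf (by
      rw [map_smul, hm, smul_smul, mul_comm, hab, zero_smul, map_zero])
    obtain ⟨m', rfl⟩ := hM.exists_of_smul_right m hbm
    obtain ⟨j, hj⟩ := hI.exists_of_smul_left (i - f m') (by
      rw [smul_sub, ← hm, map_smul, sub_self])
    refine ⟨g j, ?_⟩
    rw [← map_smul, ← hj, map_sub, hfg.apply_apply_eq_zero, sub_zero]
  exact ⟨key hab hM hI, key (mul_comm a b ▸ hab) hM.symm hI.symm⟩

end ExactPair

section Torsion

variable {R : Type u} [CommRing R] (I : Ideal R)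

/-- The map induced on `I`-torsion submodules by a linear map, as a map of `R ⧸ I`-modules. -/
def torsionBySetMap {M N : Type*} [AddCommGroup M] [Module R M] [AddCommGroup N] [Module R N]
    (f : M →ₗ[R] N) :
    Submodule.torsionBySet R M (I : Set R) →ₗ[R ⧸ I] Submodule.torsionBySet R N (I : Set R) where
  toFun x := ⟨f x, (Submodule.mem_torsionBySet_iff _ _).mpr fun r => by
    rw [← map_smul, (Submodule.mem_torsionBySet_iff _ _).mp x.2 r, map_zero]⟩
  map_add' x y := Subtype.ext (by simp)
  map_smul' r x := by
    obtain ⟨r, rfl⟩ := Ideal.Quotient.mk_surjective r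
    exact Subtype.ext (by simp)

@[simp]
theorem coe_torsionBySetMap {M N : Type*} [AddCommGroup M] [Module R M] [AddCommGroup N]
    [Module R N] (f : M →ₗ[R] N) (x : Submodule.torsionBySet R M (I : Set R)) :
    (torsionBySetMap I f x : N) = f x := rfl

/-- `I`-torsion is right adjoint to restriction of scalars along `R → R/I`, so it preserves
injectives. -/
theorem Module.Baer.torsionBySet {M : Type v} [AddCommGroup M] [Module R M]
    (hM : Module.Baer R M) :
    Module.Baer (R ⧸ I) (Submodule.torsionBySet R M (I : Set R)) := by
  intro J g
  let g' : J.comap (Ideal.Quotient.mk I) →ₗ[R] M :=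
    { toFun := fun r => g ⟨Ideal.Quotient.mk I r, r.2⟩
      map_add' := fun r s => by
        rw [← Submodule.coe_add, ← map_add]
        rfl
      map_smul' := fun r s => by
        rw [RingHom.id_apply, ← Submodule.coe_smul, ← Submodule.torsionBySet.mk_smul, ← map_smul]
        rfl }
  obtain ⟨e, he⟩ := hM _ g'
  have hmem : e 1 ∈ Submodule.torsionBySet R M (I : Set R) := by
    rw [Submodule.mem_torsionBySet_iff]
    rintro ⟨r, hr⟩
    have h0 : Ideal.Quotient.mk I r = 0 := Ideal.Quotient.eq_zero_iff_mem.mpr hr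
    have hrJ : r ∈ J.comap (Ideal.Quotient.mk I) := by
      rw [Ideal.mem_comap, h0]
      exact J.zero_mem
    have hz : (⟨Ideal.Quotient.mk I r, hrJ⟩ : J) = 0 := Subtype.ext h0
    have h1 : g' ⟨r, hrJ⟩ = g ⟨Ideal.Quotient.mk I r, hrJ⟩ := rfl
    rw [← map_smul, smul_eq_mul, mul_one, he r hrJ, h1, hz, map_zero, Submodule.coe_zero]
  refine ⟨LinearMap.toSpanSingleton (R ⧸ I) _ ⟨e 1, hmem⟩, fun q hq => ?_⟩
  obtain ⟨r, rfl⟩ := Ideal.Quotient.mk_surjective q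
  apply Subtype.ext
  rw [LinearMap.toSpanSingleton_apply, Submodule.torsionBySet.mk_smul, Submodule.coe_smul]
  change r • e 1 = _
  rw [← map_smul, smul_eq_mul, mul_one, he r hq]
  rfl

theorem mem_torsionBySet_span_singleton_iff {M : Type v} [AddCommGroup M] [Module R M] {a : R}
    {m : M} : m ∈ Submodule.torsionBySet R M (Ideal.span {a} : Set R) ↔ a • m = 0 := by
  rw [Submodule.torsionBySet_ideal_span_singleton_eq, Submodule.mem_torsionBy_iff]

end Torsion

/-- If `a` and `b` are an exact pair of zero divisors on both `R` and `M`, then passing to the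
`a`-torsion does not raise the injective dimension. -/
theorem IsExactSMulPair.hasInjectiveDimensionLE_torsionBySet {R : Type u} [CommRing R] {a b : R}
    (h : IsExactSMulPair R a b) (hab : a * b = 0) (n : ℕ) (M : ModuleCat.{u} R)
    (hM : IsExactSMulPair M a b) (hn : HasInjectiveDimensionLE M n) :
    HasInjectiveDimensionLE (ModuleCat.of (R ⧸ Ideal.span {a})
      (Submodule.torsionBySet R M (Ideal.span {a} : Set R))) n := by
  have base : ∀ E : ModuleCat.{u} R, Injective E →
      Injective (ModuleCat.of (R ⧸ Ideal.span {a})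
        (Submodule.torsionBySet R E (Ideal.span {a} : Set R))) := by
    intro E hE
    rw [← Module.injective_iff_injective_object] at hE ⊢
    exact ((Module.Baer.of_injective hE).torsionBySet _).injective
  induction n generalizing M with
  | zero =>
    simp only [HasInjectiveDimensionLE, zero_add, ← injective_iff_hasInjectiveDimensionLT_one]
      at hn ⊢
    exact base M hn
  | succ n ih =>
    let ⟨E, hE, f, _⟩ := EnoughInjectives.presentation M
    have injf : Function.Injective f.hom := (ModuleCat.mono_iff_injective f).mp ‹_›
    let S : ShortComplex (ModuleCat.{u} R) :=
      ModuleCat.shortComplexOfCompEqZero _ _ f.hom.exact_map_mkQ_range.linearMap_comp_eq_zero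
    have exactS := ModuleCat.shortComplex_shortExact S
      f.hom.exact_map_mkQ_range injf (Submodule.mkQ_surjective _)
    -- Dimension shifting: the cosyzygy has smaller injective dimension.
    have hC : HasInjectiveDimensionLE (ModuleCat.of R (E ⧸ f.hom.range)) n :=
      (exactS.hasInjectiveDimensionLT_X₃_iff n inferInstance).mpr hn
    have hEpair : IsExactSMulPair E a b :=
      h.of_baer hab (Module.Baer.of_injective ((Module.injective_iff_injective_object R E).mpr hE))
    have hCpair : IsExactSMulPair (E ⧸ f.hom.range) a b :=
      .of_exact injf f.hom.exact_map_mkQ_range (Submodule.mkQ_surjective _) hab hM hEpair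
    have hCtors := ih (ModuleCat.of R (E ⧸ f.hom.range)) hCpair hC
    let F := torsionBySetMap (Ideal.span {a}) f.hom
    let G := torsionBySetMap (Ideal.span {a}) f.hom.range.mkQ
    have exact_FG : Function.Exact F G := by
      intro y
      constructor
      · intro hy
        obtain ⟨m, hm⟩ := (f.hom.exact_map_mkQ_range y).mp (congrArg Subtype.val hy)
        refine ⟨⟨m, mem_torsionBySet_span_singleton_iff.mpr (injf ?_)⟩, Subtype.ext hm⟩
        rw [map_smul, hm, map_zero]
        exact mem_torsionBySet_span_singleton_iff.mp y.2
      · rintro ⟨m, rfl⟩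
        exact Subtype.ext (f.hom.exact_map_mkQ_range.apply_apply_eq_zero _)
    -- This is the vanishing of `Ext^1`: a torsion class has the form `b • j`, and any lift `b • i`
    -- is torsion because `a * b = 0`.
    have surj_G : Function.Surjective G := by
      rintro ⟨c, hc⟩
      rw [mem_torsionBySet_span_singleton_iff] at hc
      obtain ⟨j, rfl⟩ := hCpair.exists_of_smul_left c hc
      obtain ⟨i, rfl⟩ := Submodule.mkQ_surjective _ j
      refine ⟨⟨b • i, mem_torsionBySet_span_singleton_iff.mpr ?_⟩, Subtype.ext (map_smul _ _ _)⟩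
      rw [smul_smul, hab, zero_smul]
    have inj_F : Function.Injective F := fun x y hxy =>
      Subtype.ext (injf (congrArg Subtype.val hxy))
    let T : ShortComplex (ModuleCat.{u} (R ⧸ Ideal.span {a})) :=
      ModuleCat.shortComplexOfCompEqZero F G exact_FG.linearMap_comp_eq_zero
    have exactT := ModuleCat.shortComplex_shortExact T exact_FG inj_F surj_G
    have := base E hE
    exact (exactT.hasInjectiveDimensionLT_X₃_iff n this).mp hCtors

/-- Minimal primes are associated, so `p` lies in every prime. -/
theorem isNilpotent_of_mem_of_associatedPrimes_eq_singleton {R : Type*} [CommRing R]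
    [IsNoetherianRing R] {p : Ideal R} (hass : associatedPrimes R R = {p}) {x : R} (hx : x ∈ p) :
    IsNilpotent x := by
  rw [nilpotent_iff_mem_prime]
  intro q hq
  obtain ⟨p', hp', hle⟩ := Ideal.exists_minimalPrimes_le (I := Module.annihilator R R) (J := q)
    (by simp [(Module.annihilator_eq_bot (R := R) (M := R)).mpr inferInstance])
  have := Module.associatedPrimes.minimalPrimes_annihilator_subset_associatedPrimes R R hp'
  rw [hass, Set.mem_singleton_iff] at this
  exact hle (this ▸ hx)

theorem eq_zero_of_mul_eq_zero_of_associatedPrimes_eq_singleton {R : Type*} [CommRing R]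
    [IsNoetherianRing R] {p : Ideal R} (hass : associatedPrimes R R = {p}) {u y : R} (hu : u ∉ p)
    (h : u * y = 0) : y = 0 := by
  by_contra hy
  have hmem : u ∈ ⋃ q ∈ associatedPrimes R R, (q : Set R) := by
    rw [biUnion_associatedPrimes_eq_zero_divisors]
    exact ⟨y, hy, h⟩
  simp only [hass, Set.mem_singleton_iff, Set.iUnion_iUnion_eq_left] at hmem
  exact hu hmem

/-- A nonzero generator `x` of the unique associated prime of a Noetherian ring forms an exact pair
of zero divisors with its last nonzero power. -/
theorem exists_isExactSMulPair_of_associatedPrimes_eq_singleton {R : Type*} [CommRing R]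
    [IsNoetherianRing R] {x : R} (hass : associatedPrimes R R = {Ideal.span {x}}) (hx : x ≠ 0) :
    ∃ y : R, x * y = 0 ∧ IsExactSMulPair R x y := by
  have hnil : IsNilpotent x := isNilpotent_of_mem_of_associatedPrimes_eq_singleton hass
    (Ideal.mem_span_singleton_self x)
  have : Nontrivial R := ⟨x, 0, hx⟩
  obtain ⟨k, hk⟩ : ∃ k, nilpotencyClass x = k + 1 :=
    ⟨_, (Nat.succ_pred_eq_of_pos (pos_nilpotencyClass_iff.mpr hnil)).symm⟩
  have hk1 : x ^ (k + 1) = 0 := (nilpotencyClass_eq_succ_iff.mp hk).1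
  have hk0 : x ^ k ≠ 0 := (nilpotencyClass_eq_succ_iff.mp hk).2
  refine ⟨x ^ k, by rw [← pow_succ', hk1], fun m hm => ?_, fun m hm => ?_⟩
  -- Powers of `x` are split off `m` one at a time: a cofactor outside `p` would be a nonzerodivisor
  -- killing `x ^ (j + 1)`, which is nonzero as `j + 1 ≤ k`.
  · have key : ∀ j ≤ k, ∃ n, m = x ^ j * n := by
      intro j
      induction j with
      | zero => exact fun _ => ⟨m, by simp⟩
      | succ j ih =>
        intro hj
        obtain ⟨n, rfl⟩ := ih (by omega)
        by_cases hn : n ∈ Ideal.span {x}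
        · obtain ⟨n', rfl⟩ := Ideal.mem_span_singleton'.mp hn
          exact ⟨n', by ring⟩
        · have h0 : n * x ^ (j + 1) = 0 := by
            rw [← hm, smul_eq_mul]
            ring
          have := eq_zero_of_mul_eq_zero_of_associatedPrimes_eq_singleton hass hn h0
          exact absurd (pow_eq_zero_of_le hj this) hk0
    exact key k le_rfl
  · by_cases hn : m ∈ Ideal.span {x}
    · obtain ⟨n, rfl⟩ := Ideal.mem_span_singleton'.mp hn
      exact ⟨n, mul_comm n x⟩
    · exact absurd (eq_zero_of_mul_eq_zero_of_associatedPrimes_eq_singleton hass hn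
        (by rw [mul_comm]; exact hm)) hk0

/-- If `a` and `b` are an exact pair of zero divisors in `R`, then the annihilator of `a` is
isomorphic to `R ⧸ (a)`. -/
theorem IsExactSMulPair.nonempty_torsionBySet_equiv {R : Type*} [CommRing R] {a b : R}
    (h : IsExactSMulPair R a b) (hab : a * b = 0) :
    Nonempty (Submodule.torsionBySet R R (Ideal.span {a} : Set R) ≃ₗ[R ⧸ Ideal.span {a}]
      (R ⧸ Ideal.span {a})) := by
  let f := LinearMap.toSpanSingleton (R ⧸ Ideal.span {a})
    (Submodule.torsionBySet R R (Ideal.span {a} : Set R))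
    ⟨b, mem_torsionBySet_span_singleton_iff.mpr hab⟩
  have hf : ∀ r : R, (f (Ideal.Quotient.mk _ r) : R) = r * b := fun r => rfl
  refine ⟨(LinearEquiv.ofBijective f ⟨?_, ?_⟩).symm⟩
  · refine (injective_iff_map_eq_zero f).mpr fun q hq => ?_
    obtain ⟨r, rfl⟩ := Ideal.Quotient.mk_surjective q
    have hr : b • r = 0 := by rw [smul_eq_mul, mul_comm, ← hf, hq, Submodule.coe_zero]
    obtain ⟨s, rfl⟩ := h.exists_of_smul_right r hr
    exact Ideal.Quotient.eq_zero_iff_mem.mpr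
      (Ideal.mul_mem_right _ _ (Ideal.mem_span_singleton_self a))
  · rintro ⟨m, hm⟩
    obtain ⟨n, rfl⟩ := h.exists_of_smul_left m (mem_torsionBySet_span_singleton_iff.mp hm)
    exact ⟨Ideal.Quotient.mk _ n, Subtype.ext ((hf n).trans (mul_comm n b))⟩

theorem bot_colon_eq_torsionBySet {R : Type*} [CommRing R] (s : Set R) :
    (⊥ : Ideal R).colon s = Submodule.torsionBySet R R s := by
  ext r
  simp [Submodule.mem_colon, Submodule.mem_torsionBySet_iff, mul_comm]

theorem corollary3p4 {R : Type*} [CommRing R] [IsLocalRing R] [IsNoetherianRing R]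
    (hdim : 1 ≤ ringKrullDim R) (p : Ideal R) (hass : associatedPrimes R R = {p})
    (hp0 : p ≠ ⊥) (hp : p.IsPrincipal) :
    Nonempty (↥((⊥ : Ideal R).colon (p : Set R)) ≃ₗ[R] (R ⧸ p)) ∧
      (IsGorensteinLocalRing R → IsGorensteinIdeal p) := by
  obtain ⟨x, rfl⟩ := hp
  change associatedPrimes R R = {Ideal.span {x}} at hass
  change Ideal.span {x} ≠ ⊥ at hp0
  change Nonempty (_ ≃ₗ[R] (R ⧸ Ideal.span {x})) ∧ (_ → IsGorensteinIdeal (Ideal.span {x}))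
  have hx : x ≠ 0 := fun h => hp0 (by simp [h])
  obtain ⟨y, hxy, hpair⟩ := exists_isExactSMulPair_of_associatedPrimes_eq_singleton hass hx
  obtain ⟨e⟩ := hpair.nonempty_torsionBySet_equiv hxy
  refine ⟨⟨(LinearEquiv.ofEq _ _ (bot_colon_eq_torsionBySet _)).trans (e.restrictScalars R)⟩,
    fun hR => ⟨hR, ?_⟩⟩
  obtain ⟨n, hn⟩ := hR.finite_injectiveDimension
  have hprime : (Ideal.span {x}).IsPrime := by
    have : Ideal.span {x} ∈ associatedPrimes R R := hass ▸ rfl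
    exact this.isPrime
  exact
    { toIsLocalRing := .of_surjective' (Ideal.Quotient.mk _) Ideal.Quotient.mk_surjective
      toIsNoetherian := inferInstanceAs (IsNoetherianRing (R ⧸ Ideal.span {x}))
      finite_injectiveDimension := ⟨n, (ModuleCat.hasInjectiveDimensionLE_iff_of_linearEquiv
        (M := ModuleCat.of (R ⧸ Ideal.span {x})
          (Submodule.torsionBySet R R (Ideal.span {x} : Set R)))
        (N := ModuleCat.of (R ⧸ Ideal.span {x}) (R ⧸ Ideal.span {x})) e n).mp
        (hpair.hasInjectiveDimensionLE_torsionBySet hxy n (ModuleCat.of R R) hpair hn)⟩ }
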